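/- **Setting.** Let $L\ge 0$, $N_1,\dots,N_{L+1}\ge 0$ and $T\ge 0$ be integers. A source $r_0$ sends messages $\mathbf s_0,\mathbf s_1,\dots$ to a destination $r_{L+1}$ through relays $r_1,\dots,r_L$; link $j\in\{1,\dots,L+1\}$ joins $r_{j-1}$ to $r_j$. In each time slot $i\ge 0$ the source sends one packet that depends on $\mathbf s_0,\dots,\mathbf s_i$, each relay sends one packet that depends on what it has received at times $0,\dots,i$, and every packet is either received intact or replaced by an erasure symbol. At time $i+T$ the destination estimates $\mathbf s_i$ from what it received at times $0,\dots,i+T$. Such a streaming code is *achievable* if every message is recovered correctly, for all message sequences and all erasure patterns with at most $N_j$ erasures on link $j$ for every $j$. Its *rate* is the number of bits of a message divided by the number of bits of the longest packet; if messages lie in $\mathbb F^{k}$ and the packets of link $j$ in $\mathbb F^{n_j}$, for a finite field $\mathbb F$, the rate is $k/\max_j n_j$. Logarithms are to base $2$. Put $$k=T-\sum_{l=1}^{L+1}N_l+1,\qquad n_j=T-\sum_{l\ne j}N_l+1,\qquad n_{\max}=\max_{1\le j\le L+1}n_j ,$$ $$R(q)=\frac{T-\sum_{l}N_l+1}{T-\min_j\sum_{l\neq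 j}N_l+1+\dfrac{n_{\max}\lceil\log n_{\max}\rceil}{\log q}},\qquad C^{+}=\frac{T-\sum_{l}N_l+1}{T-\min_j\sum_{l\ne j}N_l+1}.$$ **Theorem.** Suppose $T\ge\sum_{l=1}^{L+1}N_l$. Let $\mathbb F$ be any finite field with $|\mathbb F|\ge n_{\max}$. 1. There are a generator matrix $G=[I_k\;V]\in\mathbb F^{k\times n_{\max}}$ of a systematic $(n_{\max},k)$ MDS code (any $k$ columns of $G$ are linearly independent) and an achievable streaming code with messages in $\mathbb F^k$ and rate at least $R(|\mathbb F|)$, which is a state-dependent symbol-wise decode-and-forward scheme built from $G$ in the following sense. Write $\tilde{\mathbf s}_i=(s_i[0],s_{i+1}[1],\dots,s_{i+k-1}[k-1])$ for $i\in\mathbb Z$, with $\mathbf s_t=\mathbf 0$ for $t<0$. For every erasure pattern (with at most $N_j$ erasures on each link $j$), every $j\in\{0,\dots,L\}$ and every $i\in\mathbb Z$ there is a $k\times n_{j+1}$ matrix $G_i^{(r_j)}$, obtained from $G$ by puncturing and permuting columns, such that: - every packet of $r_j$ consists of $n_{j+1}$ symbols of $\mathbb F$ together with a header of $\lceil\log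 n_{\max}\rceil$ bits per symbol; entry $l$ ($0\le l<n_{j+1}$) of the packet sent at time $t$ is the $l$-th coordinate of $\tilde{\mathbf s}_i\,G_i^{(r_j)}$ with $i=t-(N_1+\dots+N_j)-l$ (diagonal interleaving), and its header names the column of $G$ that produced it; - $G_i^{(r_0)}$ consists of the first $n_1$ columns of $G$, in order; - for $j\ge1$, the first $k-1$ coordinates of $\tilde{\mathbf s}_iG_i^{(r_j)}$ are the first $k-1$ non-erased symbols of $\tilde{\mathbf s}_iG_i^{(r_{j-1})}$, in the order in which $r_j$ receives them (packets of negative times count as not erased); - $G_i^{(r_j)}$ depends on the erasure pattern only through the erasures on links $1,\dots,j$. 2. In particular the rate is achievable without any separate bit header: for some integers $k',n_1',\dots,n_{L+1}'$ there is an achievable streaming code with messages in $\mathbb F^{k'}$ and packets in $\mathbb F^{n'_j}$ on link $j$, whose rate satisfies $k'/\max_jn'_j\ge R(|\mathbb F|)$. Moreover the gap to the upper bound $C^+$ vanishes as the field size grows: $C^{+}-R(q)\to0$ as $q\to\infty$. -/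

import Mathlib

open scoped Matrix BigOperators Topology

noncomputable section

/-- A streaming code with delay `T` over a path of nodes `r_0, r_1, …, r_{L+1}` (`L` relays).
`M` is the message alphabet and `X j` is the alphabet of the packets that node `r_j` sends over
link `j`, the link from `r_j` to `r_{j+1}` (`j = 0, …, L`). A received packet is an element of
`Option (X j)`, where `none` is the erasure symbol. There is no processing or propagation delay:
the packet of time `i` may depend on everything received up to and including time `i`. -/
structure StreamingCode (L : ℕ) (M : Type*) (X : Fin (L + 1) → Type*) (T : ℕ) where
  /-- the encoder of the source `r_0` at time `i` -/
  enc : (i : ℕ) → (Fin (i + 1) → M) → X 0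
  /-- the relaying function at time `i` of `r_{j+1}`, which receives from link `j` and sends
  over link `j + 1` -/
  relay : (j : Fin L) → (i : ℕ) → (Fin (i + 1) → Option (X j.castSucc)) → X j.succ
  /-- the decoder of the destination `r_{L+1}` that estimates message `i` at time `i + T` -/
  dec : (i : ℕ) → (Fin (i + T + 1) → Option (X (Fin.last L))) → M

/-- The erasure channel: `e = true` means that the packet is erased. -/
def erase {A : Type*} (x : A) (e : Bool) : Option A := if e then none else some x

/-- An erasure sequence with at most `N` erasures. -/
def IsErasureSeq (N : ℕ) (e : ℕ → Bool) : Prop := {t : ℕ | e t = true}.encard ≤ N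

/-- A family of erasure sequences, one per link, with at most `N j` erasures on link `j`. -/
def Admissible {L : ℕ} (N : Fin (L + 1) → ℕ) (e : Fin (L + 1) → ℕ → Bool) : Prop :=
  ∀ j, IsErasureSeq (N j) (e j)

namespace StreamingCode

variable {L : ℕ} {M : Type*} {X : Fin (L + 1) → Type*} {T : ℕ}

/-- `C.sent e s j t` is the packet that `r_j` sends at time `t` when the messages are `s` and the
erasures are `e`. -/
def sent (C : StreamingCode L M X T) (e : Fin (L + 1) → ℕ → Bool) (s : ℕ → M)
    (j : Fin (L + 1)) : ℕ → X j :=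
  Fin.induction (motive := fun j => ℕ → X j)
    (fun i => C.enc i (fun a => s a))
    (fun j x i => C.relay j i (fun a => erase (x a) (e j.castSucc a)))
    j

/-- The estimate of message `i` that the destination forms at time `i + T`. -/
def decoded (C : StreamingCode L M X T) (e : Fin (L + 1) → ℕ → Bool) (s : ℕ → M) (i : ℕ) : M :=
  C.dec i (fun a => erase (C.sent e s (Fin.last L) a) (e (Fin.last L) a))

/-- The code is `(N_1, …, N_{L+1})`-achievable: every message is recovered with delay `T`, for
all messages and all erasure sequences with at most the allowed number of erasures per link. -/
def Achievable (C : StreamingCode L M X T) (N : Fin (L + 1) → ℕ) : Prop :=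
  ∀ e, Admissible N e → ∀ (s : ℕ → M) (i : ℕ), C.decoded e s i = s i

/-- The rate of a code over arbitrary finite alphabets: the number of bits of a message, divided
by the number of bits of the longest packet. For `M = 𝔽^k`, `X j = 𝔽^(n_j)` this is
`k / max_j n_j`. -/
def bitRate (_C : StreamingCode L M X T) : ℝ :=
  Real.logb 2 (Nat.card M) / ⨆ j : Fin (L + 1), Real.logb 2 (Nat.card (X j))

end StreamingCode

/-- An `(n_1, …, n_{L+1}, k, T)_𝔽`-streaming code (`n j` is the packet length on link `j`). -/
abbrev FieldStreamingCode (F : Type*) {L : ℕ} (n : Fin (L + 1) → ℕ) (k T : ℕ) :=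
  StreamingCode L (Fin k → F) (fun j => Fin (n j) → F) T

/-- The rate `k / max {n_1, …, n_{L+1}}` of an `(n_1, …, n_{L+1}, k, T)_𝔽`-streaming code. -/
def FieldStreamingCode.rate {F : Type*} {L : ℕ} {n : Fin (L + 1) → ℕ} {k T : ℕ}
    (_C : FieldStreamingCode F n k T) : ℝ :=
  (k : ℝ) / ((Finset.univ.sup n : ℕ) : ℝ)

/-- A streaming code whose packets consist, on link `j`, of `n j` symbols of `𝔽`, each of them
accompanied by a header of `b` bits. -/
abbrev HeaderStreamingCode (F : Type*) {L : ℕ} (n : Fin (L + 1) → ℕ) (k T b : ℕ) :=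
  StreamingCode L (Fin k → F) (fun j => Fin (n j) → F × (Fin b → Bool)) T

section Parameters

variable {L : ℕ}

/-- `k = T - ∑ N_l + 1`, for `T ≥ ∑ N_l`. -/
def msgLen (N : Fin (L + 1) → ℕ) (T : ℕ) : ℕ := T + 1 - ∑ l, N l

/-- `T - ∑_{l ≠ j} N_l + 1`, for `T ≥ ∑ N_l`: the block length used on link `j`. -/
def blockLen (N : Fin (L + 1) → ℕ) (T : ℕ) (j : Fin (L + 1)) : ℕ :=
  T + 1 - ∑ l ∈ Finset.univ.erase j, N l

/-- `n_max = max_j (T - ∑_{l ≠ j} N_l + 1)`. -/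
def nMax (N : Fin (L + 1) → ℕ) (T : ℕ) : ℕ := Finset.univ.sup (blockLen N T)

/-- `min_j ∑_{l ≠ j} N_l`. -/
def minOther (N : Fin (L + 1) → ℕ) : ℕ :=
  Finset.univ.inf' Finset.univ_nonempty (fun j => ∑ l ∈ Finset.univ.erase j, N l)

/-- The total number of erasures allowed on the links before node `r_j`. -/
def startDelay (N : Fin (L + 1) → ℕ) (j : Fin (L + 1)) : ℕ := ∑ l ∈ Finset.Iio j, N l

/-- `⌈log₂ m⌉`, the number of bits of a header that names one of `m` columns. -/
def headerWidth (m : ℕ) : ℕ := ⌈Real.logb 2 m⌉₊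

/-- The upper bound on the rate, for `T ≥ ∑ N_l`. -/
def upperRate (N : Fin (L + 1) → ℕ) (T : ℕ) : ℝ :=
  ((T : ℝ) - ∑ l, (N l : ℝ) + 1) / ((T : ℝ) - (minOther N : ℝ) + 1)

/-- The rate claimed over a field with `q` elements. -/
def achievableRate (N : Fin (L + 1) → ℕ) (T q : ℕ) : ℝ :=
  ((T : ℝ) - ∑ l, (N l : ℝ) + 1) /
    ((T : ℝ) - (minOther N : ℝ) + 1 +
      (nMax N T : ℝ) * (⌈Real.logb 2 (nMax N T)⌉ : ℝ) / Real.logb 2 q)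

end Parameters

/-- `G` is a systematic generator matrix `[I_k V]` of an `(n, k)` MDS code: its first `k` columns
form the identity matrix, and any `k` of its columns are linearly independent. -/
structure IsSystematicMDS {F : Type*} [Field F] {k n : ℕ} (G : Matrix (Fin k) (Fin n) F) :
    Prop where
  le : k ≤ n
  systematic : ∀ a b : Fin k, G a (Fin.castLE le b) = if a = b then 1 else 0
  mds : ∀ c : Fin k ↪ Fin n, LinearIndependent F (fun a => Gᵀ (c a))

/-- The diagonal `(s_i[0], s_{i+1}[1], …, s_{i+k-1}[k-1])` of the message sequence, with
`s_t = 0` for `t < 0`. -/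
def diagonal {F : Type*} [Zero F] {k : ℕ} (s : ℕ → Fin k → F) (i : ℤ) : Fin k → F :=
  fun a => if 0 ≤ i + (a : ℤ) then s (i + (a : ℤ)).toNat a else 0

/-- The packet of (possibly negative) time `t` is erased; nothing is erased before time `0`. -/
def ErasedAt (e : ℕ → Bool) (t : ℤ) : Prop := ∃ u : ℕ, (u : ℤ) = t ∧ e u = true

/-- The header that names column `c`: its binary expansion. -/
def columnHeader {m : ℕ} (c : Fin m) : Fin (headerWidth m) → Bool :=
  fun a => Nat.testBit (c : ℕ) (a : ℕ)

open Classical in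
/-- `C` is a state-dependent symbol-wise decode-and-forward scheme built from the common
`(n_max, k)` code `G`. For every erasure pattern `e`, node `r_j` encodes the diagonal `i` with
the `k × n_{j+1}` matrix formed by the columns `π e j i 0, π e j i 1, …` of `G`; the symbol in
position `l` of that codeword is sent at time `i + N_1 + ⋯ + N_j + l`, as entry `l` of the
packet, together with the name of its column. -/
structure IsSymbolwiseDF {F : Type*} [Field F] {L : ℕ} (N : Fin (L + 1) → ℕ) (T : ℕ)
    (G : Matrix (Fin (msgLen N T)) (Fin (nMax N T)) F)
    (C : HeaderStreamingCode F (blockLen N T) (msgLen N T) T (headerWidth (nMax N T)))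
    (π : (Fin (L + 1) → ℕ → Bool) → (j : Fin (L + 1)) → ℤ → Fin (blockLen N T j) →
      Fin (nMax N T)) : Prop where
  /-- diagonal interleaving, and the header of each symbol -/
  sent_eq : ∀ e, Admissible N e → ∀ (s : ℕ → Fin (msgLen N T) → F) (j : Fin (L + 1)) (t : ℕ)
    (l : Fin (blockLen N T j)),
      C.sent e s j t l =
        ((diagonal s ((t : ℤ) - startDelay N j - (l : ℕ)) ᵥ* G)
            (π e j ((t : ℤ) - startDelay N j - (l : ℕ)) l),
          columnHeader (π e j ((t : ℤ) - startDelay N j - (l : ℕ)) l))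
  /-- each matrix is obtained from `G` by puncturing and permuting columns -/
  puncture_permute : ∀ e, Admissible N e → ∀ j i, Function.Injective (π e j i)
  /-- the source uses the first columns of `G` in their order -/
  source : ∀ e, Admissible N e → ∀ (i : ℤ) (l : Fin (blockLen N T 0)), (π e 0 i l : ℕ) = l
  /-- in its first `k - 1` positions on each diagonal a relay forwards the symbols that it
  received on this diagonal, in the order of their arrival: position `l` carries the non-erased
  symbol that is preceded by exactly `l` non-erased ones -/
  forward : ∀ e, Admissible N e → ∀ (j : Fin L) (i : ℤ) (l : Fin (blockLen N T j.succ)),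
    (l : ℕ) + 1 < msgLen N T →
      ∃ p : Fin (blockLen N T j.castSucc),
        ¬ ErasedAt (e j.castSucc) (i + startDelay N j.castSucc + (p : ℕ)) ∧
        (Finset.univ.filter (fun p' : Fin (blockLen N T j.castSucc) =>
          p' < p ∧ ¬ ErasedAt (e j.castSucc)
            (i + startDelay N j.castSucc + (p' : ℕ)))).card = (l : ℕ) ∧
        π e j.succ i l = π e j.castSucc i p
  /-- the columns used by a node depend only on the erasures on the links before it -/
  state : ∀ e e', Admissible N e → Admissible N e' → ∀ j : Fin (L + 1),
    (∀ l, l < j → e l = e' l) → π e j = π e' j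

end

/-!
Write `k = msgLen N T`, so that the codewords sent over link `j` have `n_j = k + N_j` symbols, one
per time slot. On each diagonal at least `k` of them arrive. The codeword of a relay starts `N_j`
slots after that of the previous node: when position `l` is due, the first `N_j + l + 1` symbols
of the incoming codeword have been sent, hence at least `min (l + 1) k` of them have arrived. A
relay can therefore forward the `l`-th arrival as long as `l < k`, and from then on it knows `k`
symbols of an MDS code together with their columns, decodes the diagonal, and sends columns that
have not been used. By `startDelay_last`, the codeword of the diagonal through coordinate `a` of
message `i` is complete at the destination at time `i + T`.

Both regimes are covered by a single rule, `nextColumn`: list the first `k` arriving columns, then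
the unused ones, and take entry `l`. That entry depends only on the first `min (l + 1) k` arrivals
(`nextColumn_congr`), which gives causality; the list has no duplicates, so the columns used are a
punctured permutation of those of `G`. The symbol sent is the symbol of this column in the
codeword of any message consistent with the arrivals: if the column has arrived, every consistent
message gives its symbol; otherwise `k` symbols have arrived and only one message is consistent
(`IsSystematicMDS.eq_of_agree`). At negative times nothing is erased, all symbols are zero and all
nodes use the columns of the source (`schedule_of_neg`), so receivers know that part of each
diagonal without receiving it. An induction along the path (`decodeForward_sent`) shows that the
causal code follows the recursively defined `schedule`.

For packets without separate headers, the same scheme is used over a field with `q ^ m` elements,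
`m ≥ log q`, and rewritten over the alphabet `F` by counting
(`StreamingCode.Achievable.recode`, `exists_fieldStreamingCode`).
-/

noncomputable section

/-! ### The order in which columns are used -/

section Columns

variable {m : ℕ}

/-- The duplicate-free list `cs` of columns, continued by the unused columns in increasing
order. -/
def completeColumns (cs : List (Fin m)) : List (Fin m) :=
  cs ++ (List.finRange m).filter (fun c => c ∉ cs)

lemma completeColumns_nodup {cs : List (Fin m)} (h : cs.Nodup) : (completeColumns cs).Nodup := by
  refine h.append ((List.nodup_finRange m).filter _) ?_
  intro a ha hb
  simp at hb
  exact hb ha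

lemma completeColumns_length {cs : List (Fin m)} (h : cs.Nodup) :
    (completeColumns cs).length = m := by
  have hmem : ∀ x, x ∈ completeColumns cs := by
    intro x
    by_cases hx : x ∈ cs <;> simp [completeColumns, hx]
  have := List.toFinset_card_of_nodup (completeColumns_nodup h)
  rw [← this, Finset.card_eq_of_equiv_fin]
  refine (Equiv.subtypeUnivEquiv ?_)
  simpa using hmem

lemma completeColumns_take_finRange (k : ℕ) :
    completeColumns ((List.finRange m).take k) = List.finRange m := by
  have hdisj : ∀ x ∈ (List.finRange m).drop k, x ∉ (List.finRange m).take k := fun x hx hx' =>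
    List.disjoint_take_drop (List.nodup_finRange m) le_rfl hx' hx
  have : (List.finRange m).filter (fun c => c ∉ (List.finRange m).take k)
      = (List.finRange m).drop k := by
    conv_lhs => arg 2; rw [← List.take_append_drop k (List.finRange m)]
    rw [List.filter_append, List.filter_eq_nil_iff.2, List.filter_eq_self.2, List.nil_append]
    · simpa using hdisj
    · simp
  rw [completeColumns, this, List.take_append_drop]

/-- The column that a node uses in position `l` of a diagonal, when `cs` lists the columns of the
symbols that it has received on this diagonal: the first `k` received columns come first, the
remaining columns follow. The fallback value of `getD` is never used when `cs` has no
duplicates. -/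
def nextColumn (k : ℕ) (cs : List (Fin m)) (l : Fin m) : Fin m :=
  (completeColumns (cs.take k)).getD l l

lemma nextColumn_eq_getElem {k : ℕ} {cs : List (Fin m)} {l : Fin m} (hk : (l : ℕ) < k)
    (hl : (l : ℕ) < cs.length) : nextColumn k cs l = cs[(l : ℕ)] := by
  rw [nextColumn, completeColumns, List.getD_append _ _ _ _ (by simp [hk, hl])]
  rw [List.getD_eq_getElem _ _ (by simp [hk, hl])]
  simp

/-- The column in position `l` is determined by the first `min (l + 1) k` received columns. This
is what makes relaying causal. -/
lemma nextColumn_congr {k : ℕ} {cs cs' : List (Fin m)} {l : Fin m}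
    (h : cs.take (min (l + 1) k) = cs'.take (min (l + 1) k))
    (hl : min ((l : ℕ) + 1) k ≤ cs.length) : nextColumn k cs l = nextColumn k cs' l := by
  rcases lt_or_ge (l : ℕ) k with hk | hk
  · rw [min_eq_left hk] at h hl
    have hl' : (l : ℕ) + 1 ≤ cs'.length := by
      have := congrArg List.length h
      simp only [List.length_take] at this
      omega
    rw [nextColumn_eq_getElem hk hl, nextColumn_eq_getElem hk hl']
    have h1 : cs[(l : ℕ)]? = cs'[(l : ℕ)]? := by
      have := congrArg (fun x => x[(l : ℕ)]?) h
      simpa using this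
    rwa [List.getElem?_eq_getElem hl, List.getElem?_eq_getElem hl', Option.some_inj] at h1
  · rw [min_eq_right (by omega)] at h
    rw [nextColumn, nextColumn, h]

lemma nextColumn_finRange (k : ℕ) (l : Fin m) : nextColumn k (List.finRange m) l = l := by
  rw [nextColumn, completeColumns_take_finRange, List.getD_eq_getElem _ _ (by simp)]
  simp

lemma nextColumn_injective {k : ℕ} {cs : List (Fin m)} (h : cs.Nodup) :
    Function.Injective (nextColumn k cs) := by
  have hn : (cs.take k).Nodup := h.sublist (List.take_sublist _ _)
  have hlen := completeColumns_length hn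
  intro a b hab
  rw [nextColumn, nextColumn, List.getD_eq_getElem _ _ (by rw [hlen]; exact a.2),
    List.getD_eq_getElem _ _ (by rw [hlen]; exact b.2),
    (completeColumns_nodup hn).getElem_inj_iff] at hab
  exact Fin.ext hab

/-- The header of a symbol identifies its column. -/
lemma columnHeader_injective : Function.Injective (columnHeader (m := m)) := by
  have hm : m ≤ 2 ^ headerWidth m := by
    have := Real.natCeil_logb_natCast 2 m
    rw [headerWidth]
    push_cast at this
    rw [this]
    exact Nat.le_pow_clog one_lt_two m
  intro c d h
  refine Fin.ext (Nat.eq_of_testBit_eq fun a => ?_)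
  rcases lt_or_ge a (headerWidth m) with ha | ha
  · exact congrFun h ⟨a, ha⟩
  · have hp : 2 ^ headerWidth m ≤ 2 ^ a := Nat.pow_le_pow_right two_pos ha
    rw [Nat.testBit_lt_two_pow (by omega), Nat.testBit_lt_two_pow (by omega)]

end Columns

/-! ### Systematic MDS codes -/

section MDS

variable {F : Type*} [Field F] {k m : ℕ}

/-- A Vandermonde matrix, normalised so that its first `k` columns form the identity. -/
lemma exists_isSystematicMDS [Fintype F] (hk : k ≤ m) (hm : m ≤ Fintype.card F) :
    ∃ G : Matrix (Fin k) (Fin m) F, IsSystematicMDS G := by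
  obtain ⟨x⟩ : Nonempty (Fin m ↪ F) :=
    Function.Embedding.nonempty_of_card_le (by simpa using hm)
  let W : Matrix (Fin k) (Fin m) F := Matrix.of fun a c => x c ^ (a : ℕ)
  have hW : ∀ c : Fin k ↪ Fin m, IsUnit (W.submatrix id c) := by
    intro c
    have : W.submatrix id c = (Matrix.vandermonde (fun a => x (c a)))ᵀ := by
      ext a b
      simp [W, Matrix.vandermonde]
    rw [this, Matrix.isUnit_transpose, Matrix.isUnit_iff_isUnit_det, isUnit_iff_ne_zero,
      Matrix.det_vandermonde_ne_zero_iff]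
    exact x.injective.comp c.injective
  let A := W.submatrix id (Fin.castLEEmb hk)
  have hA : IsUnit A := hW (Fin.castLEEmb hk)
  have hA' : IsUnit A⁻¹ := (Matrix.isUnit_nonsing_inv_iff).2 hA
  refine ⟨A⁻¹ * W, hk, fun a b => ?_, fun c => ?_⟩
  · have h1 : A⁻¹ * A = 1 := Matrix.nonsing_inv_mul _ ((Matrix.isUnit_iff_isUnit_det _).1 hA)
    have h2 := congrFun (congrFun h1 a) b
    rw [Matrix.one_apply] at h2
    rw [← h2]
    rfl
  · have h1 : (fun a => (A⁻¹ * W)ᵀ (c a)) = (A⁻¹ * W.submatrix id c)ᵀ.row := rfl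
    rw [h1, Matrix.linearIndependent_rows_iff_isUnit, Matrix.isUnit_transpose]
    exact hA'.mul (hW c)

/-- A message is determined by any `k` symbols of its codeword. -/
lemma IsSystematicMDS.eq_of_agree {G : Matrix (Fin k) (Fin m) F} (hG : IsSystematicMDS G)
    {cs : List (Fin m)} (hn : cs.Nodup) (hlen : k ≤ cs.length) {d d' : Fin k → F}
    (h : ∀ c ∈ cs, (d ᵥ* G) c = (d' ᵥ* G) c) : d = d' := by
  let c : Fin k ↪ Fin m := ⟨fun a => cs[(a : ℕ)], fun a b hab => by
    simpa [hn.getElem_inj_iff, Fin.ext_iff] using hab⟩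
  have hu : IsUnit (G.submatrix id c) := by
    rw [← Matrix.isUnit_transpose, ← Matrix.linearIndependent_rows_iff_isUnit]
    exact hG.mds c
  refine Matrix.vecMul_injective_of_isUnit hu (funext fun a => ?_)
  exact h (c a) (List.getElem_mem _)

lemma IsSystematicMDS.vecMul_castLE {G : Matrix (Fin k) (Fin m) F} (hG : IsSystematicMDS G)
    (d : Fin k → F) {c : Fin m} (hc : (c : ℕ) < k) : (d ᵥ* G) c = d ⟨c, hc⟩ := by
  have key : ∀ a, (d ᵥ* G) (Fin.castLE hG.le a) = d a := fun a => by
    simp [Matrix.vecMul, dotProduct, hG.systematic]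
  exact key ⟨c, hc⟩

end MDS

/-! ### Diagonals and arrivals -/

section Arrivals

/-- On a diagonal, the symbols of negative times vanish if they belong to the columns of the
same index. -/
lemma vecMul_diagonal_eq_zero {F : Type*} [Field F] {k m : ℕ} {G : Matrix (Fin k) (Fin m) F}
    (hG : IsSystematicMDS G) (s : ℕ → Fin k → F) {i : ℤ} {c : Fin m} (hi : i + (c : ℕ) < 0) :
    (diagonal s i ᵥ* G) c = 0 := by
  rcases lt_or_ge (c : ℕ) k with hc | hc
  · rw [hG.vecMul_castLE _ hc]
    exact if_neg (by simpa using hi)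
  · have : diagonal s i = 0 := by
      funext a
      have := a.2
      exact if_neg (by omega)
    rw [this, Matrix.zero_vecMul]
    rfl

open Classical in
/-- The positions, in increasing order, of the symbols that are not erased, in a codeword of
length `n` whose first symbol is sent at time `τ`. -/
def arrivals (n : ℕ) (e : ℕ → Bool) (τ : ℤ) : List (Fin n) :=
  (List.finRange n).filter (fun p : Fin n => ¬ ErasedAt e (τ + (p : ℕ)))

open Classical in
/-- The part of `arrivals n e τ` that lies among the first `c` positions. -/
def arrivalsBefore (c n : ℕ) (e : ℕ → Bool) (τ : ℤ) : List (Fin n) :=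
  ((List.finRange n).take c).filter (fun p : Fin n => ¬ ErasedAt e (τ + (p : ℕ)))

variable {n : ℕ} {e : ℕ → Bool} {τ : ℤ}

lemma arrivals_pairwise (n : ℕ) (e : ℕ → Bool) (τ : ℤ) :
    (arrivals n e τ).Pairwise (· < ·) :=
  (List.pairwise_lt_finRange n).filter _

lemma arrivals_nodup (n : ℕ) (e : ℕ → Bool) (τ : ℤ) : (arrivals n e τ).Nodup :=
  (List.nodup_finRange n).filter _

lemma mem_arrivals {p : Fin n} : p ∈ arrivals n e τ ↔ ¬ ErasedAt e (τ + (p : ℕ)) := by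
  simp [arrivals]

lemma arrivalsBefore_prefix (c n : ℕ) (e : ℕ → Bool) (τ : ℤ) :
    arrivalsBefore c n e τ <+: arrivals n e τ :=
  (List.take_prefix c _).filter _

lemma arrivalsBefore_length_ge {N : ℕ} (he : IsErasureSeq N e) (c : ℕ) :
    min c n ≤ (arrivalsBefore c n e τ).length + N := by
  classical
  set P := (List.finRange n).take c with hP
  have hPn : P.Nodup := (List.nodup_finRange n).sublist (List.take_sublist _ _)
  have hsplit : P.length = (P.filter (fun p : Fin n => ¬ ErasedAt e (τ + (p : ℕ)))).length
      + (P.filter (fun p : Fin n => ErasedAt e (τ + (p : ℕ)))).length := by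
    rw [← List.countP_eq_length_filter, ← List.countP_eq_length_filter, add_comm]
    have := List.length_eq_countP_add_countP (l := P)
      (fun p : Fin n => decide (ErasedAt e (τ + (p : ℕ))))
    simpa using this
  have hle : (P.filter (fun p : Fin n => ErasedAt e (τ + (p : ℕ)))).length ≤ N := by
    rw [← List.toFinset_card_of_nodup (hPn.filter _)]
    set S := (P.filter (fun p : Fin n => ErasedAt e (τ + (p : ℕ)))).toFinset with hS
    have hmem : ∀ p ∈ S, ∃ u : ℕ, (u : ℤ) = τ + ((p : ℕ) : ℤ) ∧ e u = true := by
      intro p hp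
      simp [hS] at hp
      exact hp.2
    have hinj : Set.InjOn (fun p : Fin n => (τ + ((p : ℕ) : ℤ)).toNat) S := by
      intro p hp p' hp' hpp
      obtain ⟨u, hu, -⟩ := hmem p hp
      obtain ⟨u', hu', -⟩ := hmem p' hp'
      simp only at hpp
      exact Fin.ext (by omega)
    have hsub : ((S.image fun p : Fin n => (τ + ((p : ℕ) : ℤ)).toNat : Finset ℕ) : Set ℕ)
        ⊆ {t | e t = true} := by
      intro t ht
      simp only [Finset.coe_image, Set.mem_image, Finset.mem_coe] at ht
      obtain ⟨p, hp, rfl⟩ := ht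
      obtain ⟨u, hu, h⟩ := hmem p hp
      simpa [← hu] using h
    have h1 := (Set.encard_le_encard hsub).trans he
    rw [Set.encard_coe_eq_coe_finsetCard, Finset.card_image_of_injOn hinj] at h1
    exact_mod_cast h1
  have hlen : P.length = min c n := by simp [hP]
  have : arrivalsBefore c n e τ = P.filter (fun p : Fin n => ¬ ErasedAt e (τ + (p : ℕ))) := rfl
  rw [this]
  omega

/-- Exactly `l` arrivals precede the one with index `l`. -/
lemma card_arrivals_lt {l : ℕ} (hl : l < (arrivals n e τ).length) :
    (Finset.univ.filter (fun p => p < (arrivals n e τ)[l] ∧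
      p ∈ arrivals n e τ)).card = l := by
  classical
  have hmono := arrivals_pairwise n e τ
  have hs : (Finset.univ.filter (fun p => p < (arrivals n e τ)[l] ∧ p ∈ arrivals n e τ))
      = ((arrivals n e τ).take l).toFinset := by
    ext p
    simp only [Finset.mem_filter, Finset.mem_univ, true_and, List.mem_toFinset]
    constructor
    · rintro ⟨h1, h2⟩
      obtain ⟨a, ha, rfl⟩ := List.getElem_of_mem h2
      refine List.mem_take_iff_getElem.2 ⟨a, ?_, rfl⟩
      by_contra hcon
      have hla : l ≤ a := by omega
      rcases hla.eq_or_lt with rfl | hla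
      · exact lt_irrefl _ h1
      · exact lt_asymm h1 (List.pairwise_iff_getElem.1 hmono l a hl ha hla)
    · intro h
      obtain ⟨a, ha, rfl⟩ := List.mem_take_iff_getElem.1 h
      exact ⟨List.pairwise_iff_getElem.1 hmono a l (by omega) hl (by omega),
        List.getElem_mem _⟩
  rw [hs, List.toFinset_card_of_nodup ((arrivals_nodup n e τ).sublist (List.take_sublist _ _))]
  simp only [List.length_take]
  omega

end Arrivals

/-! ### Block lengths and delays -/

section Lengths

variable {L : ℕ} {N : Fin (L + 1) → ℕ} {T : ℕ}

lemma msgLen_pos (hT : ∑ l, N l ≤ T) : 0 < msgLen N T := by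
  rw [msgLen]
  omega

lemma blockLen_eq (hT : ∑ l, N l ≤ T) (j : Fin (L + 1)) :
    blockLen N T j = msgLen N T + N j := by
  have := Finset.sum_erase_add Finset.univ N (Finset.mem_univ j)
  rw [msgLen, blockLen]
  omega

lemma blockLen_le_nMax (N : Fin (L + 1) → ℕ) (T : ℕ) (j : Fin (L + 1)) :
    blockLen N T j ≤ nMax N T :=
  Finset.le_sup (f := blockLen N T) (Finset.mem_univ j)

lemma msgLen_le_nMax (hT : ∑ l, N l ≤ T) : msgLen N T ≤ nMax N T := by
  have h1 := blockLen_le_nMax N T 0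
  rw [blockLen_eq hT] at h1
  omega

lemma startDelay_zero (N : Fin (L + 1) → ℕ) : startDelay N 0 = 0 := by
  rw [startDelay, Finset.sum_eq_zero]
  intro l hl
  simp at hl

lemma startDelay_succ (N : Fin (L + 1) → ℕ) (j : Fin L) :
    startDelay N j.succ = startDelay N j.castSucc + N j.castSucc := by
  have : Finset.Iio j.succ = insert j.castSucc (Finset.Iio j.castSucc) := by
    ext l
    simp only [Finset.mem_Iio, Finset.mem_insert, Fin.lt_def, Fin.ext_iff, Fin.val_succ,
      Fin.val_castSucc]
    omega
  rw [startDelay, this, Finset.sum_insert (by simp), startDelay, add_comm]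

lemma startDelay_last (N : Fin (L + 1) → ℕ) :
    startDelay N (Fin.last L) + N (Fin.last L) = ∑ l, N l := by
  have : Finset.Iio (Fin.last L) = Finset.univ.erase (Fin.last L) := by
    ext l
    rw [Finset.mem_Iio, Fin.lt_last_iff_ne_last, Finset.mem_erase]
    simp
  rw [startDelay, this, Finset.sum_erase_add _ _ (Finset.mem_univ _)]

end Lengths

/-! ### The columns used by each node -/

section Schedule

variable {L : ℕ} {N : Fin (L + 1) → ℕ} {T : ℕ}

/-- The columns that node `r_j` uses on diagonal `i` under the erasure pattern `e`. A relay
continues the list of the columns that arrive on this diagonal by `nextColumn`. -/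
def schedule (N : Fin (L + 1) → ℕ) (T : ℕ) (e : Fin (L + 1) → ℕ → Bool) (j : Fin (L + 1)) :
    ℤ → Fin (blockLen N T j) → Fin (nMax N T) :=
  Fin.induction (motive := fun j => ℤ → Fin (blockLen N T j) → Fin (nMax N T))
    (fun _ l => Fin.castLE (blockLen_le_nMax N T 0) l)
    (fun j prev i l => nextColumn (msgLen N T)
      ((arrivals (blockLen N T j.castSucc) (e j.castSucc) (i + startDelay N j.castSucc)).map
        (prev i)) (Fin.castLE (blockLen_le_nMax N T j.succ) l))
    j

lemma schedule_zero (e : Fin (L + 1) → ℕ → Bool) (i : ℤ) (l : Fin (blockLen N T 0)) :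
    schedule N T e 0 i l = Fin.castLE (blockLen_le_nMax N T 0) l := rfl

lemma schedule_succ (e : Fin (L + 1) → ℕ → Bool) (j : Fin L) (i : ℤ)
    (l : Fin (blockLen N T j.succ)) :
    schedule N T e j.succ i l = nextColumn (msgLen N T)
      ((arrivals (blockLen N T j.castSucc) (e j.castSucc) (i + startDelay N j.castSucc)).map
        (schedule N T e j.castSucc i)) (Fin.castLE (blockLen_le_nMax N T j.succ) l) := rfl

lemma schedule_injective (e : Fin (L + 1) → ℕ → Bool) (j : Fin (L + 1)) (i : ℤ) :
    Function.Injective (schedule N T e j i) := by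
  induction j using Fin.induction with
  | zero => exact Fin.castLE_injective (blockLen_le_nMax N T 0)
  | succ j ih =>
    intro a b h
    rw [schedule_succ, schedule_succ] at h
    exact Fin.castLE_injective _ (nextColumn_injective ((arrivals_nodup _ _ _).map ih) h)

lemma schedule_congr {e e' : Fin (L + 1) → ℕ → Bool} (j : Fin (L + 1))
    (h : ∀ l, l < j → e l = e' l) : schedule N T e j = schedule N T e' j := by
  induction j using Fin.induction with
  | zero => rfl
  | succ j ih =>
    funext i l
    rw [schedule_succ, schedule_succ, h _ j.castSucc_lt_succ,
      ih fun l hl => h l (hl.trans j.castSucc_lt_succ)]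

/-- Nothing is erased before time `0`, hence the columns used at negative times are known in
advance: they are those of the source. -/
lemma schedule_of_neg (hT : ∑ l, N l ≤ T) (e : Fin (L + 1) → ℕ → Bool) (j : Fin (L + 1)) (i : ℤ)
    (p : Fin (blockLen N T j)) (hp : i + startDelay N j + (p : ℕ) < 0) :
    schedule N T e j i p = Fin.castLE (blockLen_le_nMax N T j) p := by
  induction j using Fin.induction with
  | zero => rfl
  | succ j ih =>
    rw [startDelay_succ] at hp
    push_cast at hp
    have hlen := blockLen_eq hT j.castSucc
    have hle := blockLen_le_nMax N T j.castSucc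
    rw [schedule_succ]
    conv_rhs => rw [← nextColumn_finRange (msgLen N T) (Fin.castLE _ p)]
    set r := min ((p : ℕ) + 1) (msgLen N T) with hr
    set n := blockLen N T j.castSucc with hn
    have hr1 : r ≤ p + 1 := min_le_left _ _
    have hr2 : r ≤ n := by omega
    have hpre : (List.finRange n).take r <+:
        arrivals n (e j.castSucc) (i + startDelay N j.castSucc) := by
      have h1 : arrivalsBefore r n (e j.castSucc) (i + startDelay N j.castSucc)
          = (List.finRange n).take r := by
        refine List.filter_eq_self.2 fun q hq => ?_
        obtain ⟨a, ha, rfl⟩ := List.mem_take_iff_getElem.1 hq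
        classical
        rw [decide_eq_true_eq]
        rintro ⟨u, hu, -⟩
        simp at hu ha
        omega
      exact h1 ▸ arrivalsBefore_prefix _ _ _ _
    have hmap : ((List.finRange n).take r).map (schedule N T e j.castSucc i)
        = (List.finRange (nMax N T)).take r := by
      refine List.ext_getElem (by simp; omega) fun a h1 h2 => ?_
      simp only [List.length_map, List.length_take, List.length_finRange] at h1
      rw [List.getElem_map, ih]
      · ext
        simp
      · simp
        omega
    have hlist := (hpre.map (schedule N T e j.castSucc i))
    rw [hmap] at hlist
    have hlr : ((List.finRange (nMax N T)).take r).length = r := by simp; omega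
    refine nextColumn_congr ?_ ?_
    · have := List.prefix_iff_eq_take.1 hlist
      rw [hlr] at this
      rw [Fin.val_castLE, ← hr, ← this]
    · have := hlist.length_le
      rw [hlr] at this
      exact this

end Schedule

/-! ### The relaying scheme -/

section Scheme

variable {F : Type*} [Field F]

/-- What a node knows at time `t` about position `p` of diagonal `i`, when the symbol of that
position is sent at time `i + D + p`: the symbol and its column. Symbols of negative times are
known to be zero and to belong to column `p`. -/
def observe {n m D t : ℕ} (h : n ≤ m)
    (y : Fin (t + 1) → Option (Fin n → F × (Fin (headerWidth m) → Bool))) (i : ℤ) (p : Fin n) :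
    Option (F × Fin m) :=
  haveI : Nonempty (Fin m) := ⟨Fin.castLE h p⟩
  if i + D + (p : ℕ) < 0 then some (0, Fin.castLE h p)
  else if ht : (i + D + (p : ℕ)).toNat < t + 1 then
    (y ⟨(i + D + (p : ℕ)).toNat, ht⟩).map fun x => ((x p).1, Function.invFun columnHeader (x p).2)
  else none

/-- The symbols of diagonal `i`, with their columns, that a node has received by time `t`, in the
order of their arrival. -/
def received {n m : ℕ} (D : ℕ) {t : ℕ} (h : n ≤ m)
    (y : Fin (t + 1) → Option (Fin n → F × (Fin (headerWidth m) → Bool))) (i : ℤ) :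
    List (F × Fin m) :=
  (List.finRange n).filterMap (observe (D := D) h y i)

/-- Some message whose codeword agrees with the given symbols. -/
def consistentMessage {k m : ℕ} (G : Matrix (Fin k) (Fin m) F) (r : List (F × Fin m)) :
    Fin k → F :=
  Classical.epsilon fun d => ∀ x ∈ r, (d ᵥ* G) x.2 = x.1

lemma vecMul_consistentMessage {k m : ℕ} {G : Matrix (Fin k) (Fin m) F} {cs : List (Fin m)}
    (d : Fin k → F) {c : Fin m} (hc : c ∈ cs) :
    (consistentMessage G (cs.map fun c => ((d ᵥ* G) c, c)) ᵥ* G) c = (d ᵥ* G) c := by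
  have := Classical.epsilon_spec (p := fun d' : Fin k → F =>
    ∀ x ∈ cs.map fun c => ((d ᵥ* G) c, c), (d' ᵥ* G) x.2 = x.1) ⟨d, by simp⟩
  exact this _ (List.mem_map_of_mem (f := fun c => ((d ᵥ* G) c, c)) hc)

lemma filterMap_eq_map_filter {α β : Type*} {f : α → Option β} {P : α → Bool} {g : α → β}
    {l : List α} (h : ∀ a ∈ l, f a = if P a then some (g a) else none) :
    l.filterMap f = (l.filter P).map g := by
  induction l with
  | nil => rfl
  | cons a l ih =>
    have ha := h a (by simp)
    have hl := ih fun b hb => h b (by simp [hb])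
    by_cases hP : P a <;> simp [hP] at ha <;> simp [ha, hP, hl]

lemma received_eq {k n m D t : ℕ} {h : n ≤ m} {G : Matrix (Fin k) (Fin m) F}
    {x : ℕ → Fin n → F × (Fin (headerWidth m) → Bool)} {e : ℕ → Bool} {i : ℤ}
    {col : Fin n → Fin m} {d : Fin k → F} {c : ℕ}
    (hx : ∀ (u : ℕ) (p : Fin n), (u : ℤ) = i + D + (p : ℕ) →
      x u p = ((d ᵥ* G) (col p), columnHeader (col p)))
    (hneg : ∀ p : Fin n, i + D + (p : ℕ) < 0 → col p = Fin.castLE h p ∧ (d ᵥ* G) (col p) = 0)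
    (hc : ∀ p : Fin n, i + D + (p : ℕ) ≤ t ↔ (p : ℕ) < c) :
    received D h (fun a : Fin (t + 1) => erase (x a) (e a)) i
      = ((arrivalsBefore c n e (i + D)).map col).map fun c => ((d ᵥ* G) c, c) := by
  classical
  rw [received, List.map_map]
  conv_lhs => rw [← List.take_append_drop c (List.finRange n)]
  rw [List.filterMap_append, filterMap_eq_map_filter (l := (List.finRange n).take c)
    (P := fun p : Fin n => ¬ ErasedAt e (i + D + (p : ℕ)))
    (g := (fun c => ((d ᵥ* G) c, c)) ∘ col), List.filterMap_eq_nil_iff.2, List.append_nil]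
  · rfl
  · intro p hp
    obtain ⟨a, ha, rfl⟩ := List.mem_drop_iff_getElem.1 hp
    have := hc ((List.finRange n)[c + a])
    simp only [List.getElem_finRange, Fin.val_cast] at this ⊢
    rw [observe, if_neg, dif_neg]
    · simp
      omega
    · simp
      omega
  · intro p hp
    have hpc : (p : ℕ) < c := by
      obtain ⟨a, ha, rfl⟩ := List.mem_take_iff_getElem.1 hp
      simp at ha ⊢
      omega
    have hpt := (hc p).2 hpc
    rcases lt_or_ge (i + D + (p : ℕ)) 0 with h0 | h0
    · have hne : ¬ ErasedAt e (i + D + (p : ℕ)) := by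
        rintro ⟨u, hu, -⟩
        omega
      rw [observe, if_pos h0]
      obtain ⟨h1, h2⟩ := hneg p h0
      simp only [hne, not_false_eq_true, decide_true, if_true, Function.comp, h2]
      rw [h1]
    · obtain ⟨u, hu⟩ := Int.eq_ofNat_of_zero_le h0
      have hiff : ErasedAt e (i + D + (p : ℕ)) ↔ e u = true := by
        constructor
        · rintro ⟨v, hv, he⟩
          have : v = u := by omega
          exact this ▸ he
        · exact fun he => ⟨u, hu.symm, he⟩
      have : Nonempty (Fin m) := ⟨col p⟩
      rw [observe, if_neg (by omega), dif_pos (by omega)]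
      simp only [hiff]
      simp only [hu, Int.toNat_natCast, erase]
      by_cases he : e u = true
      · simp [he]
      · simp [he, hx u p hu.symm, Function.leftInverse_invFun columnHeader_injective _]

variable {L : ℕ} {N : Fin (L + 1) → ℕ} {T : ℕ}

/-- The decode-and-forward code built from `G`. Whatever a node sends on a diagonal is a symbol of
the codeword of some message consistent with what has arrived: this forwards received columns
unchanged, and it re-encodes once `k` symbols have arrived. -/
def decodeForward (N : Fin (L + 1) → ℕ) (T : ℕ)
    (G : Matrix (Fin (msgLen N T)) (Fin (nMax N T)) F) :
    HeaderStreamingCode F (blockLen N T) (msgLen N T) T (headerWidth (nMax N T)) where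
  enc t s l :=
    let c := Fin.castLE (blockLen_le_nMax N T 0) l
    ((diagonal (fun u => if h : u < t + 1 then s ⟨u, h⟩ else 0) ((t : ℤ) - (l : ℕ)) ᵥ* G) c,
      columnHeader c)
  relay j t y l :=
    let r := received (startDelay N j.castSucc) (blockLen_le_nMax N T j.castSucc) y
      ((t : ℤ) - startDelay N j.succ - (l : ℕ))
    let c := nextColumn (msgLen N T) (r.map Prod.snd)
      (Fin.castLE (blockLen_le_nMax N T j.succ) l)
    ((consistentMessage G r ᵥ* G) c, columnHeader c)
  dec i y a :=
    consistentMessage G (received (startDelay N (Fin.last L))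
      (blockLen_le_nMax N T (Fin.last L)) y ((i : ℤ) - (a : ℕ))) a

/-- The symbol in position `l` of a diagonal depends only on messages that the source knows when
it sends it. -/
lemma vecMul_diagonal_truncate {k m : ℕ} {G : Matrix (Fin k) (Fin m) F} (hG : IsSystematicMDS G)
    (s : ℕ → Fin k → F) (t : ℕ) (c : Fin m) :
    (diagonal (fun u => if u < t + 1 then s u else 0) ((t : ℤ) - (c : ℕ)) ᵥ* G) c
      = (diagonal s ((t : ℤ) - (c : ℕ)) ᵥ* G) c := by
  have key : ∀ a : Fin k, (a : ℕ) ≤ c →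
      diagonal (fun u => if u < t + 1 then s u else 0) ((t : ℤ) - (c : ℕ)) a
        = diagonal s ((t : ℤ) - (c : ℕ)) a := by
    intro a ha
    simp only [diagonal]
    split_ifs with h1 h2
    · rfl
    · omega
    · rfl
  rcases lt_or_ge (c : ℕ) k with hc | hc
  · rw [hG.vecMul_castLE _ hc, hG.vecMul_castLE _ hc, key _ le_rfl]
  · rw [show diagonal _ _ = diagonal s _ from funext fun a => key a (by omega)]

/-- The symbols that a node has received on a diagonal, in terms of the schedule. -/
lemma received_sent (hT : ∑ l, N l ≤ T) {G : Matrix (Fin (msgLen N T)) (Fin (nMax N T)) F}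
    (hG : IsSystematicMDS G) (e : Fin (L + 1) → ℕ → Bool) (s : ℕ → Fin (msgLen N T) → F)
    (j : Fin (L + 1)) {x : ℕ → Fin (blockLen N T j) → F × (Fin (headerWidth (nMax N T)) → Bool)}
    (hx : ∀ (t : ℕ) (l : Fin (blockLen N T j)),
      x t l = ((diagonal s ((t : ℤ) - startDelay N j - (l : ℕ)) ᵥ* G)
            (schedule N T e j ((t : ℤ) - startDelay N j - (l : ℕ)) l),
          columnHeader (schedule N T e j ((t : ℤ) - startDelay N j - (l : ℕ)) l)))
    {i : ℤ} {t c : ℕ}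
    (hc : ∀ p : Fin (blockLen N T j), i + startDelay N j + (p : ℕ) ≤ t ↔ (p : ℕ) < c) :
    received (startDelay N j) (blockLen_le_nMax N T j)
        (fun a : Fin (t + 1) => erase (x a) (e j a)) i
      = ((arrivalsBefore c (blockLen N T j) (e j) (i + startDelay N j)).map
          (schedule N T e j i)).map fun c => ((diagonal s i ᵥ* G) c, c) := by
  refine received_eq ?_ ?_ hc
  · intro u p hu
    have : (u : ℤ) - startDelay N j - (p : ℕ) = i := by omega
    rw [hx, this]
  · intro p hp
    have h1 := schedule_of_neg hT e j i p hp
    refine ⟨h1, ?_⟩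
    rw [h1]
    refine vecMul_diagonal_eq_zero hG s ?_
    rw [Fin.val_castLE]
    omega

lemma arrivals_columns_nodup (e : Fin (L + 1) → ℕ → Bool) (j : Fin (L + 1)) (i : ℤ) (c : ℕ) :
    ((arrivalsBefore c (blockLen N T j) (e j) (i + startDelay N j)).map
      (schedule N T e j i)).Nodup :=
  ((arrivals_nodup _ _ _).sublist (arrivalsBefore_prefix _ _ _ _).sublist).map
    (schedule_injective e j i)

/-- Every node sends the symbols that the schedule prescribes. -/
lemma decodeForward_sent (hT : ∑ l, N l ≤ T)
    {G : Matrix (Fin (msgLen N T)) (Fin (nMax N T)) F} (hG : IsSystematicMDS G)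
    {e : Fin (L + 1) → ℕ → Bool} (he : Admissible N e) (s : ℕ → Fin (msgLen N T) → F)
    (j : Fin (L + 1)) (t : ℕ) (l : Fin (blockLen N T j)) :
    (decodeForward N T G).sent e s j t l
      = ((diagonal s ((t : ℤ) - startDelay N j - (l : ℕ)) ᵥ* G)
            (schedule N T e j ((t : ℤ) - startDelay N j - (l : ℕ)) l),
          columnHeader (schedule N T e j ((t : ℤ) - startDelay N j - (l : ℕ)) l)) := by
  induction j using Fin.induction generalizing t with
  | zero =>
    rw [schedule_zero, startDelay_zero]
    have h := vecMul_diagonal_truncate hG s t (Fin.castLE (blockLen_le_nMax N T 0) l)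
    simp only [Nat.cast_zero, sub_zero]
    exact Prod.ext h rfl
  | succ j ih =>
    have hlen := blockLen_eq hT j.castSucc
    have hstep := startDelay_succ N j
    set i := (t : ℤ) - startDelay N j.succ - (l : ℕ) with hi
    -- By time `t`, the first `N_j + l + 1` positions of the previous codeword have been sent.
    have hr := received_sent hT hG e s j.castSucc
      (x := (decodeForward N T G).sent e s j.castSucc) (fun t l => ih t l)
      (i := i) (t := t) (c := N j.castSucc + l + 1) (fun p => by omega)
    have hcol : ((arrivalsBefore (N j.castSucc + l + 1) (blockLen N T j.castSucc)
          (e j.castSucc) (i + startDelay N j.castSucc)).map (schedule N T e j.castSucc i))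
        <+: (arrivals (blockLen N T j.castSucc) (e j.castSucc)
          (i + startDelay N j.castSucc)).map (schedule N T e j.castSucc i) :=
      (arrivalsBefore_prefix _ _ _ _).map _
    have hmany := arrivalsBefore_length_ge (he j.castSucc) (N j.castSucc + l + 1)
      (n := blockLen N T j.castSucc) (τ := i + startDelay N j.castSucc)
    have hnodup := arrivals_columns_nodup (N := N) (T := T) e j.castSucc i
      (N j.castSucc + l + 1)
    set cs := (arrivalsBefore (N j.castSucc + l + 1) (blockLen N T j.castSucc)
          (e j.castSucc) (i + startDelay N j.castSucc)).map (schedule N T e j.castSucc i)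
      with hcs
    have hlcs : min ((l : ℕ) + 1) (msgLen N T) ≤ cs.length := by
      rw [hcs, List.length_map]
      omega
    have hsched : nextColumn (msgLen N T) cs (Fin.castLE (blockLen_le_nMax N T j.succ) l)
        = schedule N T e j.succ i l := by
      rw [schedule_succ]
      refine nextColumn_congr ?_ hlcs
      obtain ⟨cs', hcs'⟩ := hcol
      rw [← hcs', Fin.val_castLE, List.take_append_of_le_length hlcs]
    have hdef : (decodeForward N T G).sent e s j.succ t l
        = (fun r : List (F × Fin (nMax N T)) =>
          ((consistentMessage G r ᵥ* G) (nextColumn (msgLen N T) (r.map Prod.snd)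
              (Fin.castLE (blockLen_le_nMax N T j.succ) l)),
            columnHeader (nextColumn (msgLen N T) (r.map Prod.snd)
              (Fin.castLE (blockLen_le_nMax N T j.succ) l))))
          (received (startDelay N j.castSucc) (blockLen_le_nMax N T j.castSucc)
            (fun a : Fin (t + 1) =>
              erase ((decodeForward N T G).sent e s j.castSucc a) (e j.castSucc a)) i) := rfl
    have hsnd : (cs.map fun c => ((diagonal s i ᵥ* G) c, c)).map Prod.snd = cs := by
      simp [Function.comp_def]
    rw [hdef, hr]
    simp only [hsnd, hsched]
    refine Prod.ext ?_ rfl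
    simp only
    -- Either the symbol was received, or enough symbols were received to decode the diagonal.
    rcases lt_or_ge (l : ℕ) (msgLen N T) with hl | hl
    · refine vecMul_consistentMessage _ ?_
      have hll : (l : ℕ) < cs.length := by omega
      rw [← hsched, nextColumn_eq_getElem (by exact hl) (by exact hll)]
      exact List.getElem_mem _
    · rw [hG.eq_of_agree hnodup (by omega) fun c hc => vecMul_consistentMessage _ hc]

lemma decodeForward_achievable (hT : ∑ l, N l ≤ T)
    {G : Matrix (Fin (msgLen N T)) (Fin (nMax N T)) F} (hG : IsSystematicMDS G) :
    (decodeForward N T G).Achievable N := by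
  intro e he s i
  funext a
  have hlen := blockLen_eq hT (Fin.last L)
  have hstep := startDelay_last N
  have hk : msgLen N T = T + 1 - ∑ l, N l := rfl
  -- The whole codeword of the diagonal `i - a` is sent by time `i + T`.
  have hr := received_sent hT hG e s (Fin.last L)
    (x := (decodeForward N T G).sent e s (Fin.last L))
    (decodeForward_sent hT hG he s (Fin.last L))
    (i := (i : ℤ) - (a : ℕ)) (t := i + T) (c := blockLen N T (Fin.last L))
    (fun p => by have := p.2; omega)
  have hmany := arrivalsBefore_length_ge (he (Fin.last L)) (blockLen N T (Fin.last L))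
    (n := blockLen N T (Fin.last L)) (τ := (i : ℤ) - (a : ℕ) + startDelay N (Fin.last L))
  have hnodup := arrivals_columns_nodup (N := N) (T := T) e (Fin.last L) ((i : ℤ) - (a : ℕ))
    (blockLen N T (Fin.last L))
  have hdef : (decodeForward N T G).decoded e s i a
      = consistentMessage G (received (startDelay N (Fin.last L))
        (blockLen_le_nMax N T (Fin.last L)) (fun a : Fin (i + T + 1) =>
          erase ((decodeForward N T G).sent e s (Fin.last L) a) (e (Fin.last L) a))
        ((i : ℤ) - (a : ℕ))) a := rfl
  rw [hdef, hr, hG.eq_of_agree hnodup (by rw [List.length_map]; omega)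
    fun c hc => vecMul_consistentMessage _ hc]
  simp [diagonal]

/-- In its first `k` positions a relay uses the columns that arrive, in the same order. -/
lemma schedule_forward (hT : ∑ l, N l ≤ T) {e : Fin (L + 1) → ℕ → Bool} (he : Admissible N e)
    (j : Fin L) (i : ℤ) (l : Fin (blockLen N T j.succ)) (hl : (l : ℕ) < msgLen N T) :
    ∃ h : (l : ℕ) < (arrivals (blockLen N T j.castSucc) (e j.castSucc)
        (i + startDelay N j.castSucc)).length,
      schedule N T e j.succ i l = schedule N T e j.castSucc i
        (arrivals (blockLen N T j.castSucc) (e j.castSucc)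
          (i + startDelay N j.castSucc))[(l : ℕ)] := by
  have hlen := blockLen_eq hT j.castSucc
  have h1 := (arrivalsBefore_prefix (blockLen N T j.castSucc) (blockLen N T j.castSucc)
    (e j.castSucc) (i + startDelay N j.castSucc)).length_le
  have h2 := arrivalsBefore_length_ge (he j.castSucc) (blockLen N T j.castSucc)
    (n := blockLen N T j.castSucc) (τ := i + startDelay N j.castSucc)
  refine ⟨by omega, ?_⟩
  rw [schedule_succ, nextColumn_eq_getElem (by exact hl) (by simp; omega)]
  simp

lemma decodeForward_isSymbolwiseDF (hT : ∑ l, N l ≤ T)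
    {G : Matrix (Fin (msgLen N T)) (Fin (nMax N T)) F} (hG : IsSystematicMDS G) :
    IsSymbolwiseDF N T G (decodeForward N T G) (schedule N T) where
  sent_eq _ he s j t l := decodeForward_sent hT hG he s j t l
  puncture_permute e _ j i := schedule_injective e j i
  source _ _ _ _ := rfl
  forward e he j i l hl := by
    obtain ⟨h, heq⟩ := schedule_forward hT he j i l (by omega)
    refine ⟨_, mem_arrivals.1 (List.getElem_mem h), ?_, heq⟩
    simp only [← mem_arrivals]
    convert card_arrivals_lt h
  state _ _ _ _ j h := schedule_congr j h

end Scheme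

/-! ### Change of alphabets -/

namespace StreamingCode

variable {L : ℕ} {M M' : Type*} {X X' : Fin (L + 1) → Type*} {T : ℕ}

/-- The code `C` with messages and packets written in other alphabets. -/
def recode (C : StreamingCode L M X T) (φ : M' → M) (ψ : M → M') (f : ∀ j, X j → X' j)
    (g : ∀ j, X' j → X j) : StreamingCode L M' X' T where
  enc i s := f 0 (C.enc i fun a => φ (s a))
  relay j i y := f j.succ (C.relay j i fun a => (y a).map (g j.castSucc))
  dec i y := ψ (C.dec i fun a => (y a).map (g (Fin.last L)))

lemma recode_sent (C : StreamingCode L M X T) (φ : M' → M) (ψ : M → M') {f : ∀ j, X j → X' j}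
    {g : ∀ j, X' j → X j} (hfg : ∀ j x, g j (f j x) = x) (e : Fin (L + 1) → ℕ → Bool)
    (s : ℕ → M') (j : Fin (L + 1)) (t : ℕ) :
    (C.recode φ ψ f g).sent e s j t = f j (C.sent e (fun i => φ (s i)) j t) := by
  induction j using Fin.induction generalizing t with
  | zero => rfl
  | succ j ih =>
    change f j.succ (C.relay j t fun a => (erase ((C.recode φ ψ f g).sent e s j.castSucc a)
      (e j.castSucc a)).map (g j.castSucc)) = f j.succ (C.relay j t fun a =>
        erase (C.sent e (fun i => φ (s i)) j.castSucc a) (e j.castSucc a))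
    congr 2
    funext a
    rw [ih, erase, erase]
    split_ifs <;> simp [hfg]

lemma Achievable.recode {C : StreamingCode L M X T} {N : Fin (L + 1) → ℕ} (hC : C.Achievable N)
    {φ : M' → M} {ψ : M → M'} (hφ : ∀ x, ψ (φ x) = x) {f : ∀ j, X j → X' j}
    {g : ∀ j, X' j → X j} (hfg : ∀ j x, g j (f j x) = x) :
    (C.recode φ ψ f g).Achievable N := by
  intro e he s i
  rw [← hφ (s i), ← hC e he (fun i => φ (s i)) i]
  change ψ (C.dec i fun a => (erase ((C.recode φ ψ f g).sent e s (Fin.last L) a)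
      (e (Fin.last L) a)).map (g (Fin.last L))) = ψ (C.dec i fun a =>
        erase (C.sent e (fun i => φ (s i)) (Fin.last L) a) (e (Fin.last L) a))
  congr 2
  funext a
  rw [recode_sent _ _ _ hfg, erase, erase]
  split_ifs <;> simp [hfg]

end StreamingCode

/-! ### Rates -/

section Rates

variable {L : ℕ} {N : Fin (L + 1) → ℕ} {T : ℕ}

lemma nMax_add_minOther (hT : ∑ l, N l ≤ T) : nMax N T + minOther N = T + 1 := by
  have hle : ∀ j, ∑ l ∈ Finset.univ.erase j, N l ≤ T := fun j =>
    (Finset.sum_le_sum_of_subset (Finset.erase_subset _ _)).trans hT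
  obtain ⟨j, -, hj⟩ := Finset.exists_mem_eq_inf' Finset.univ_nonempty
    (fun j : Fin (L + 1) => ∑ l ∈ Finset.univ.erase j, N l)
  have h1 : minOther N = ∑ l ∈ Finset.univ.erase j, N l := hj
  refine le_antisymm ?_ ?_
  · have : nMax N T ≤ T + 1 - minOther N := Finset.sup_le fun i _ =>
      Nat.sub_le_sub_left (Finset.inf'_le (fun j => ∑ l ∈ Finset.univ.erase j, N l)
        (Finset.mem_univ i)) _
    have := hle j
    omega
  · have h2 := blockLen_le_nMax N T j
    rw [blockLen] at h2
    omega

lemma cast_msgLen (hT : ∑ l, N l ≤ T) : (msgLen N T : ℝ) = (T : ℝ) - ∑ l, (N l : ℝ) + 1 := by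
  rw [msgLen, Nat.cast_sub (by omega)]
  push_cast
  ring

lemma cast_nMax (hT : ∑ l, N l ≤ T) : (nMax N T : ℝ) = (T : ℝ) - (minOther N : ℝ) + 1 := by
  have : (nMax N T : ℝ) + minOther N = T + 1 := by exact_mod_cast nMax_add_minOther hT
  linarith

lemma nMax_pos (hT : ∑ l, N l ≤ T) : 0 < nMax N T :=
  (msgLen_pos hT).trans_le (msgLen_le_nMax hT)

lemma upperRate_eq (hT : ∑ l, N l ≤ T) :
    upperRate N T = (msgLen N T : ℝ) / (nMax N T : ℝ) := by
  rw [upperRate, cast_msgLen hT, cast_nMax hT]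

lemma achievableRate_eq (hT : ∑ l, N l ≤ T) (q : ℕ) :
    achievableRate N T q = (msgLen N T : ℝ) /
      ((nMax N T : ℝ) + (nMax N T : ℝ) * (headerWidth (nMax N T) : ℝ) / Real.logb 2 q) := by
  have h1 : (1 : ℝ) ≤ (nMax N T : ℝ) := by exact_mod_cast nMax_pos hT
  have h2 : (headerWidth (nMax N T) : ℝ) = (⌈Real.logb 2 (nMax N T)⌉ : ℝ) :=
    natCast_ceil_eq_intCast_ceil (Real.logb_nonneg one_lt_two h1)
  rw [achievableRate, h2, cast_msgLen hT, cast_nMax hT]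

/-- A header of `b` bits per symbol lengthens a packet of `n` symbols by `n b / log q` symbols. -/
lemma bitRate_eq_achievableRate (hT : ∑ l, N l ≤ T) {F : Type*} [Field F] [Fintype F]
    (C : HeaderStreamingCode F (blockLen N T) (msgLen N T) T (headerWidth (nMax N T))) :
    C.bitRate = achievableRate N T (Fintype.card F) := by
  have hq : 0 < Real.logb 2 (Fintype.card F) :=
    Real.logb_pos one_lt_two (by exact_mod_cast Fintype.one_lt_card)
  have hq0 : (Fintype.card F : ℝ) ≠ 0 := by simp
  set b := headerWidth (nMax N T) with hb
  have hX : ∀ j, Real.logb 2 (Nat.card (Fin (blockLen N T j) → F × (Fin b → Bool)))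
      = (blockLen N T j : ℝ) * (Real.logb 2 (Fintype.card F) + b) := by
    intro j
    have : Nat.card (Fin (blockLen N T j) → F × (Fin b → Bool))
        = (Fintype.card F * 2 ^ b) ^ blockLen N T j := by
      simp [Nat.card_eq_fintype_card]
    rw [this]
    push_cast
    rw [Real.logb_pow, Real.logb_mul hq0 (by positivity), Real.logb_pow,
      Real.logb_self_eq_one one_lt_two, mul_one]
  have hM : Real.logb 2 (Nat.card (Fin (msgLen N T) → F))
      = (msgLen N T : ℝ) * Real.logb 2 (Fintype.card F) := by
    have : Nat.card (Fin (msgLen N T) → F) = Fintype.card F ^ msgLen N T := by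
      simp [Nat.card_eq_fintype_card]
    rw [this]
    push_cast
    rw [Real.logb_pow]
  have hc : 0 ≤ Real.logb 2 (Fintype.card F) + (b : ℝ) := by positivity
  have hsup : (⨆ j : Fin (L + 1), (blockLen N T j : ℝ) * (Real.logb 2 (Fintype.card F) + b))
      = (nMax N T : ℝ) * (Real.logb 2 (Fintype.card F) + b) := by
    refine le_antisymm (ciSup_le fun j => ?_) ?_
    · exact mul_le_mul_of_nonneg_right (by exact_mod_cast blockLen_le_nMax N T j) hc
    · obtain ⟨j, -, hj⟩ := Finset.exists_mem_eq_sup Finset.univ Finset.univ_nonempty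
        (blockLen N T)
      rw [show nMax N T = blockLen N T j from hj]
      exact le_ciSup (f := fun j : Fin (L + 1) =>
        (blockLen N T j : ℝ) * (Real.logb 2 (Fintype.card F) + b)) (Set.finite_range _).bddAbove j
  have hn : (0 : ℝ) < nMax N T := by exact_mod_cast nMax_pos hT
  rw [achievableRate_eq hT, StreamingCode.bitRate, hM]
  rw [← hb]
  simp only [hX, hsup]
  field_simp

lemma tendsto_upperRate_sub_achievableRate (hT : ∑ l, N l ≤ T) :
    Filter.Tendsto (fun q : ℕ => upperRate N T - achievableRate N T q) Filter.atTop (𝓝 0) := by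
  have hn : (nMax N T : ℝ) ≠ 0 := by exact_mod_cast (nMax_pos hT).ne'
  have hlog : Filter.Tendsto (fun q : ℕ => Real.logb 2 q) Filter.atTop Filter.atTop :=
    (Real.tendsto_logb_atTop one_lt_two).comp tendsto_natCast_atTop_atTop
  have h1 := (hlog.const_div_atTop
    ((nMax N T : ℝ) * (headerWidth (nMax N T) : ℝ))).const_add (nMax N T : ℝ)
  rw [add_zero] at h1
  have h2 := ((tendsto_const_nhds (x := (msgLen N T : ℝ))).div h1 hn).const_sub (upperRate N T)
  rw [upperRate_eq hT, sub_self] at h2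
  refine h2.congr fun q => ?_
  rw [upperRate_eq hT, achievableRate_eq hT]
  rfl

end Rates

/-! ### Achievability -/

section Achievability

variable {L : ℕ} {N : Fin (L + 1) → ℕ} {T : ℕ}

/-- A finite field of cardinality `q ^ m`, for a power `m` of the cardinality `q` of a field. -/
lemma exists_field_card_eq_pow (F : Type*) [Field F] [Fintype F] {m : ℕ} (hm : m ≠ 0) :
    ∃ (K : Type) (_ : Field K) (_ : Fintype K), Fintype.card K = Fintype.card F ^ m := by
  obtain ⟨p, -, d, hp, hF⟩ := FiniteField.card' F
  have := Fact.mk hp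
  refine ⟨GaloisField p (d * m), inferInstance, Fintype.ofFinite _, ?_⟩
  rw [hF, ← pow_mul, Fintype.card_eq_nat_card,
    GaloisField.card p _ (mul_ne_zero d.pos.ne' hm)]

/-- The headers can be absorbed into packets over `F`. In the scheme over a field with `q ^ m`
elements each symbol is written as `m` symbols of `F`, followed by one symbol of `F` per header
bit. With `log q ≤ m` the headers lengthen the packets by a factor of at most
`1 + b / m ≤ 1 + b / log q`. -/
lemma exists_fieldStreamingCode (hT : ∑ l, N l ≤ T) (F : Type*) [Field F] [Fintype F]
    (hF : nMax N T ≤ Fintype.card F) :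
    ∃ (k : ℕ) (n : Fin (L + 1) → ℕ) (C : FieldStreamingCode F n k T),
      C.Achievable N ∧ achievableRate N T (Fintype.card F) ≤ FieldStreamingCode.rate C := by
  set q := Fintype.card F with hq
  have hq1 : 1 < q := Fintype.one_lt_card
  have hlog : 0 < Real.logb 2 q := Real.logb_pos one_lt_two (by exact_mod_cast hq1)
  set m := ⌈Real.logb 2 q⌉₊ with hm
  have hm0 : 0 < m := Nat.ceil_pos.2 hlog
  obtain ⟨K, _, _, hK⟩ := exists_field_card_eq_pow F hm0.ne'
  obtain ⟨G, hG⟩ := exists_isSystematicMDS (F := K) (msgLen_le_nMax hT)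
    (hF.trans (hK ▸ Nat.le_self_pow hm0.ne' q))
  set b := headerWidth (nMax N T) with hb
  obtain ⟨φ⟩ : Nonempty ((Fin (msgLen N T * m) → F) ≃ (Fin (msgLen N T) → K)) :=
    Fintype.card_eq.1 (by simp [hK, ← hq, ← pow_mul, mul_comm])
  have hf : ∀ j, Nonempty ((Fin (blockLen N T j) → K × (Fin b → Bool)) ↪
      (Fin (blockLen N T j * (m + b)) → F)) := by
    intro j
    refine Function.Embedding.nonempty_of_card_le ?_
    simp only [Fintype.card_fun, Fintype.card_prod, Fintype.card_fin, Fintype.card_bool, hK,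
      ← hq]
    rw [mul_comm (blockLen N T j), pow_mul, pow_add]
    gcongr
    exact hq1
  let f := fun j => (hf j).some
  refine ⟨msgLen N T * m, fun j => blockLen N T j * (m + b),
    (decodeForward N T G).recode φ φ.symm (fun j => f j) (fun j => Function.invFun (f j)),
    (decodeForward_achievable hT hG).recode (by simp)
      (fun j => Function.leftInverse_invFun (f j).injective), ?_⟩
  rw [achievableRate_eq hT, FieldStreamingCode.rate, ← hb]
  have hsup : Finset.univ.sup (fun j => blockLen N T j * (m + b)) ≤ nMax N T * (m + b) :=
    Finset.sup_le fun j _ => Nat.mul_le_mul_right _ (blockLen_le_nMax N T j)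
  have hpos : 0 < Finset.univ.sup (fun j => blockLen N T j * (m + b)) := by
    refine lt_of_lt_of_le ?_ (Finset.le_sup (Finset.mem_univ (0 : Fin (L + 1))))
    have := msgLen_pos hT
    rw [blockLen_eq hT]
    positivity
  have hn : (0 : ℝ) < nMax N T := by exact_mod_cast nMax_pos hT
  have hmr : (0 : ℝ) < m := by exact_mod_cast hm0
  calc (msgLen N T : ℝ) / ((nMax N T : ℝ) + (nMax N T : ℝ) * (b : ℝ) / Real.logb 2 q)
      ≤ (msgLen N T : ℝ) / ((nMax N T : ℝ) + (nMax N T : ℝ) * (b : ℝ) / m) := by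
        gcongr
        exact Nat.le_ceil _
    _ = ((msgLen N T * m : ℕ) : ℝ) / ((nMax N T * (m + b) : ℕ) : ℝ) := by
        push_cast
        field_simp
    _ ≤ _ := by
        gcongr

end Achievability

end

theorem mainTheorem2 (L : ℕ) (N : Fin (L + 1) → ℕ) (T : ℕ) (hT : ∑ l, N l ≤ T) :
    (∀ (F : Type*) [Field F] [Fintype F], nMax N T ≤ Fintype.card F →
      (∃ (G : Matrix (Fin (msgLen N T)) (Fin (nMax N T)) F)
          (C : HeaderStreamingCode F (blockLen N T) (msgLen N T) T (headerWidth (nMax N T)))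
          (π : (Fin (L + 1) → ℕ → Bool) → (j : Fin (L + 1)) → ℤ → Fin (blockLen N T j) →
            Fin (nMax N T)),
        IsSystematicMDS G ∧ IsSymbolwiseDF N T G C π ∧ C.Achievable N ∧
          achievableRate N T (Fintype.card F) ≤ C.bitRate) ∧
      (∃ (k : ℕ) (n : Fin (L + 1) → ℕ) (C : FieldStreamingCode F n k T),
        C.Achievable N ∧ achievableRate N T (Fintype.card F) ≤ FieldStreamingCode.rate C)) ∧
    Filter.Tendsto (fun q : ℕ => upperRate N T - achievableRate N T q) Filter.atTop (𝓝 0) := by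
  refine ⟨fun F _ _ hF => ⟨?_, exists_fieldStreamingCode hT F hF⟩,
    tendsto_upperRate_sub_achievableRate hT⟩
  obtain ⟨G, hG⟩ := exists_isSystematicMDS (F := F) (msgLen_le_nMax hT) hF
  exact ⟨G, decodeForward N T G, schedule N T, hG, decodeForward_isSymbolwiseDF hT hG,
    decodeForward_achievable hT hG, (bitRate_eq_achievableRate hT _).ge⟩
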